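/- Let $k$ be a positive integer or $k=\infty$. A real normed space $X$ is said to admit $C^k$ partitions of unity if for every covering $\mathcal V$ of $X$ by open sets there is a locally finite partition of unity $(\varphi_i)_{i\in I}$ on $X$ (so each $\varphi_i\ge 0$, every point of $X$ has a neighbourhood on which all but finitely many $\varphi_i$ vanish, and $\sum_{i\in I}\varphi_i=1$ on $X$) consisting of functions $\varphi_i:X\to\mathbb R$ of class $C^k$ in the Fréchet sense and subordinate to $\mathcal V$, that is, the closed support of each $\varphi_i$ is contained in some member of $\mathcal V$. Let $\Omega$ be an ordinal and let $E$ be a real Banach space admitting $C^k$ partitions of unity. Then the Banach space $C([0,\Omega];E)$ of continuous functions from $[0,\Omega]$ (the set of ordinals $\alpha\le\Omega$ with the order topology) to $E$, with the supremum norm, also admits $C^k$ partitions of unity. -/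

import Mathlib

universe u v

/-- A real normed space `X` admits partitions of unity of class `C^k`: for every covering `𝒱` of
`X` by open sets there is a (locally finite, continuous) partition of unity on `X` that consists of
functions of class `C^k` in the Fréchet sense and is subordinate to `𝒱`, i.e. the closed support of
each of its members is contained in some member of `𝒱`.
Here `k : ℕ∞`, so `k` is a natural number or `∞` (infinitely differentiable). -/
def AdmitsPartitionsOfUnity (k : ℕ∞) (X : Type u) [NormedAddCommGroup X] [NormedSpace ℝ X] :
    Prop :=
  ∀ 𝒱 : Set (Set X), (∀ V ∈ 𝒱, IsOpen V) → ⋃₀ 𝒱 = Set.univ →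
    ∃ (ι : Type u) (f : PartitionOfUnity ι X Set.univ),
      (∀ i, ContDiff ℝ k (f i)) ∧ ∀ i, ∃ V ∈ 𝒱, tsupport (f i) ⊆ V

/-! ### Partitions of unity from σ-locally finite families of `C^k` functions. -/

section SigmaLocallyFinite

open Set Function Filter Topology Metric

variable {X : Type*} [NormedAddCommGroup X] [NormedSpace ℝ X] {k : ℕ∞}

/-! A σ-locally finite base of cozero sets of `C^k` functions suffices
(`AdmitsPartitionsOfUnity.of_sigmaLocallyFinite_base`); one is built on `C(K, E)` for `K` compact
and well-ordered. Call `x (succ α) - x α` the jump of `x` at `α`.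

By continuity only finitely many jumps of `x` have norm at least a given δ > 0
(`finite_norm_jump_ge`). Moreover `x` is uniformly close to a step function determined by its values
on a finite set `F` of points with nonzero jump (`exists_finset_norm_dev_lt`). A basic set therefore
records three things: the jumps on `F` exceed a threshold, the values on `F` lie in small sets, and
`x` is close to its step function over `F`. For a fixed threshold, the first two conditions already
force local finiteness.

The third condition needs a `C^k` function, although the supremum norm is not smooth. `exists_bump`
supplies it as a cut-off of a locally finite sum over points and thresholds. This sum detects every
failure of closeness, because the last point of failure has a nonzero jump (`exists_last_jump`). -/

theorem contDiffAt_finsum {ι : Type*} {f : ι → X → ℝ} {x : X}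
    (hf : ∀ i, ContDiffAt ℝ k (f i) x) {I : Finset ι}
    (hI : ∀ᶠ y in 𝓝 x, (support fun i => f i y) ⊆ I) :
    ContDiffAt ℝ k (fun y => ∑ᶠ i, f i y) x := by
  have h : ContDiffAt ℝ k (fun y => ∑ i ∈ I, f i y) x := ContDiffAt.sum fun i _ => hf i
  exact h.congr_of_eventuallyEq (hI.mono fun y hy => finsum_eq_sum_of_support_subset _ hy)

theorem LocallyFinite.contDiff_finsum {ι : Type*} {f : ι → X → ℝ}
    (hlf : LocallyFinite fun i => support (f i)) (hf : ∀ i, ContDiff ℝ k (f i)) :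
    ContDiff ℝ k (fun y => ∑ᶠ i, f i y) :=
  contDiff_iff_contDiffAt.2 fun x =>
    let ⟨_, hI⟩ := hlf.exists_finset_support x
    contDiffAt_finsum (fun i => (hf i).contDiffAt) hI

theorem LocallyFinite.finsum_pos {Y ι : Type*} [TopologicalSpace Y] {f : ι → Y → ℝ}
    (hlf : LocallyFinite fun i => support (f i)) (h0 : ∀ i x, 0 ≤ f i x) {x : Y} {i : ι}
    (hi : f i x ≠ 0) : 0 < ∑ᶠ i, f i x :=
  ((h0 i x).lt_of_ne' hi).trans_le
    (single_le_finsum i (hlf.point_finite x) fun j => h0 j x)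

/-- A smooth cut-off which is `1` at `0` and vanishes on `[1, ∞)`. -/
noncomputable def smoothCutoff (t : ℝ) : ℝ := Real.smoothTransition (1 - t)

theorem smoothCutoff_zero : smoothCutoff 0 = 1 := by simp [smoothCutoff]

theorem smoothCutoff_of_one_le {t : ℝ} (ht : 1 ≤ t) : smoothCutoff t = 0 :=
  Real.smoothTransition.zero_of_nonpos (by linarith)

theorem smoothCutoff_nonneg (t : ℝ) : 0 ≤ smoothCutoff t := Real.smoothTransition.nonneg _

theorem contDiff_smoothCutoff : ContDiff ℝ k smoothCutoff :=
  Real.smoothTransition.contDiff.comp (contDiff_const.sub contDiff_id)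

/-- The standard disjointing of a countable cover by cozero sets. -/
theorem exists_locallyFinite_disjointing {g : ℕ → X → ℝ} (hg : ∀ n, ContDiff ℝ k (g n))
    (h0 : ∀ n x, 0 ≤ g n x) (hpos : ∀ x, ∃ n, g n x ≠ 0) :
    ∃ h : ℕ → X → ℝ, (∀ n, ContDiff ℝ k (h n)) ∧ (∀ n x, 0 ≤ h n x) ∧
      (LocallyFinite fun n => support (h n)) ∧ ∀ x, ∃ n, g n x ≠ 0 ∧ h n x ≠ 0 := by
  -- The `n`-th product vanishes once some `g m x` with `m < n` reaches `1 / (n + 1)`. It equals `1`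
  -- when `n` is the first index with `g n x ≠ 0`.
  refine ⟨fun n x => ∏ m ∈ Finset.range n, smoothCutoff ((n + 1) * g m x), fun n => ?_,
    fun n x => Finset.prod_nonneg fun m _ => smoothCutoff_nonneg _, fun x => ?_, fun x => ?_⟩
  · exact contDiff_prod fun m _ => contDiff_smoothCutoff.comp (contDiff_const.mul (hg m))
  · obtain ⟨m, hm⟩ := hpos x
    have hm : 0 < g m x := (h0 m x).lt_of_ne' hm
    obtain ⟨N, hN⟩ := exists_nat_one_div_lt (half_pos hm)
    refine ⟨{y | g m x / 2 < g m y},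
      (hg m).continuous.continuousAt.eventually (lt_mem_nhds (half_lt_self hm)),
      (finite_Iio (max N (m + 1))).subset ?_⟩
    rintro n ⟨y, hy, hy'⟩
    by_contra hn
    simp only [mem_Iio, not_lt, max_le_iff] at hn
    refine hy (Finset.prod_eq_zero (Finset.mem_range.2 hn.2) (smoothCutoff_of_one_le ?_))
    have h1 : (N : ℝ) ≤ n := by exact_mod_cast hn.1
    have h2 : 1 < (g m x / 2) * (N + 1) := (div_lt_iff₀ (by positivity)).1 hN
    have h3 : g m x / 2 < g m y := hy'
    have h4 : (g m x / 2) * (N + 1) ≤ g m y * (n + 1) :=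
      mul_le_mul h3.le (by linarith) (by positivity) (h0 m y)
    linarith
  · classical
    refine ⟨Nat.find (hpos x), Nat.find_spec (hpos x), ?_⟩
    refine (Finset.prod_eq_one fun m hm => ?_).trans_ne one_ne_zero
    have : g m x = 0 := by simpa using Nat.find_min (hpos x) (Finset.mem_range.1 hm)
    rw [this, mul_zero, smoothCutoff_zero]

/-- Disjointing the sums of the levels gives locally finite weights `h n`. Near a point only
finitely many levels survive multiplication by them, so the whole family becomes locally finite and
can be normalised. -/
theorem exists_partitionOfUnity_of_sigmaLocallyFinite {ι : ℕ → Type*} {f : ∀ n, ι n → X → ℝ}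
    (hf : ∀ n i, ContDiff ℝ k (f n i)) (h0 : ∀ n i x, 0 ≤ f n i x)
    (hlf : ∀ n, LocallyFinite fun i => support (f n i)) (hpos : ∀ x, ∃ n i, f n i x ≠ 0) :
    ∃ F : PartitionOfUnity (Σ n, ι n) X univ, (∀ p, ContDiff ℝ k (F p)) ∧
      ∀ p, tsupport (F p) ⊆ tsupport (f p.1 p.2) := by
  obtain ⟨h, hh, hh0, hhlf, hhpos⟩ := exists_locallyFinite_disjointing
    (fun n => (hlf n).contDiff_finsum (hf n)) (fun n x => finsum_nonneg fun i => h0 n i x)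
    (fun x => by
      obtain ⟨n, i, hi⟩ := hpos x
      exact ⟨n, ((hlf n).finsum_pos (h0 n) hi).ne'⟩)
  let G : (Σ n, ι n) → X → ℝ := fun p x => f p.1 p.2 x * h p.1 x
  have hG : ∀ p, ContDiff ℝ k (G p) := fun p => (hf _ _).mul (hh _)
  have hG0 : ∀ p x, 0 ≤ G p x := fun p x => mul_nonneg (h0 _ _ _) (hh0 _ _)
  have hGlf : LocallyFinite fun p => support (G p) := by
    intro x
    obtain ⟨t, ht, hfin⟩ := hhlf x
    choose s hs hsfin using fun n => hlf n x
    refine ⟨t ∩ ⋂ n ∈ hfin.toFinset, s n,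
      inter_mem ht ((biInter_finset_mem _).2 fun n _ => hs n), ?_⟩
    refine (hfin.toFinset.finite_toSet.biUnion fun n _ =>
      (hsfin n).image (Sigma.mk n)).subset ?_
    rintro ⟨n, i⟩ ⟨y, hy, hyt, hys⟩
    have hn : n ∈ hfin.toFinset := hfin.mem_toFinset.2 ⟨y, right_ne_zero_of_mul hy, hyt⟩
    exact mem_biUnion hn ⟨i, ⟨y, left_ne_zero_of_mul hy, mem_iInter₂.1 hys n hn⟩, rfl⟩
  have hGpos : ∀ x, 0 < ∑ᶠ p, G p x := fun x => by
    obtain ⟨n, hn, hn'⟩ := hhpos x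
    obtain ⟨i, hi⟩ : ∃ i, f n i x ≠ 0 := by
      by_contra! h
      exact hn (finsum_eq_zero_of_forall_eq_zero h)
    exact hGlf.finsum_pos hG0 (i := ⟨n, i⟩) (mul_ne_zero hi hn')
  have hF : ∀ p, ContDiff ℝ k fun x => G p x / ∑ᶠ q, G q x := fun p =>
    (hG p).div (hGlf.contDiff_finsum hG) fun x => (hGpos x).ne'
  have hsum : ∀ x, ∑ᶠ p, G p x / ∑ᶠ q, G q x = 1 := fun x => by
    simp_rw [div_eq_mul_inv]
    rw [← finsum_mul' _ _ (hGlf.point_finite x), mul_inv_cancel₀ (hGpos x).ne']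
  refine ⟨{ toFun := fun p => ⟨fun x => G p x / ∑ᶠ q, G q x, (hF p).continuous⟩
            locallyFinite' := hGlf.subset fun p x hx => ?_
            nonneg' := fun p x => div_nonneg (hG0 p x) (hGpos x).le
            sum_eq_one' := fun x _ => hsum x
            sum_le_one' := fun x => (hsum x).le }, hF, fun p => closure_mono fun x hx => ?_⟩
  · intro h
    exact hx (by simp [h])
  · intro h
    refine hx ?_
    change G p x / _ = 0
    simp [G, h]

end SigmaLocallyFinite

/-! ### The base criterion. -/

section Criterion

open Set Function Filter Topology Metric

universe w

/-- A normed space with a `σ`-locally finite base of cozero sets of `C^k` functions admits `C^k`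
partitions of unity. -/
theorem AdmitsPartitionsOfUnity.of_sigmaLocallyFinite_base {X : Type w} [NormedAddCommGroup X]
    [NormedSpace ℝ X] {k : ℕ∞} {ι : ℕ → Type w} {f : ∀ n, ι n → X → ℝ}
    (hf : ∀ n i, ContDiff ℝ k (f n i)) (h0 : ∀ n i x, 0 ≤ f n i x)
    (hlf : ∀ n, LocallyFinite fun i => support (f n i))
    (hbase : ∀ x, ∀ r > 0, ∃ n i, f n i x ≠ 0 ∧ tsupport (f n i) ⊆ ball x r) :
    AdmitsPartitionsOfUnity k X := by
  intro 𝒱 hopen hcover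
  -- Discarding the functions not subordinate to the cover preserves local finiteness, and the base
  -- property keeps the remaining ones nonvanishing somewhere at each point.
  obtain ⟨F, hF, hsupp⟩ := exists_partitionOfUnity_of_sigmaLocallyFinite
    (ι := fun n => {i : ι n // ∃ V ∈ 𝒱, tsupport (f n i) ⊆ V}) (f := fun n i => f n i)
    (fun n i => hf n i) (fun n i => h0 n i)
    (fun n => (hlf n).comp_injective Subtype.coe_injective) fun x => by
      obtain ⟨V, hV, hx⟩ := mem_sUnion.1 (hcover ▸ mem_univ x)
      obtain ⟨r, hr, hrV⟩ := Metric.isOpen_iff.1 (hopen V hV) x hx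
      obtain ⟨n, i, hi, hi'⟩ := hbase x r hr
      exact ⟨n, ⟨i, V, hV, hi'.trans hrV⟩, hi⟩
  refine ⟨_, F, hF, fun p => ?_⟩
  obtain ⟨V, hV, h⟩ := p.2.2
  exact ⟨V, hV, (hsupp p).trans h⟩

end Criterion

/-! ### Separating functions and partitions with small supports. -/

section Urysohn

open Set Function Filter Topology Metric

universe w

variable {X : Type w} [NormedAddCommGroup X] [NormedSpace ℝ X] {k : ℕ∞}

/-- A `C^k` function separating a ball from the complement of a larger one. -/
theorem AdmitsPartitionsOfUnity.exists_separating (hX : AdmitsPartitionsOfUnity k X) {a b : ℝ}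
    (hab : a < b) :
    ∃ ψ : X → ℝ, ContDiff ℝ k ψ ∧ (∀ v, 0 ≤ ψ v) ∧ (∀ v, ‖v‖ ≤ a → ψ v = 0) ∧
      ∀ v, b ≤ ‖v‖ → ψ v = 1 := by
  obtain ⟨ι, f, hf, hsub⟩ := hX {ball 0 b, (closedBall 0 a)ᶜ}
    (by rintro V (rfl | rfl); exacts [isOpen_ball, isClosed_closedBall.isOpen_compl])
    (by
      refine eq_univ_of_forall fun v => ?_
      rcases lt_or_ge ‖v‖ b with h | h
      · exact ⟨_, Or.inl rfl, by simpa using h⟩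
      · exact ⟨_, Or.inr rfl, by simpa using hab.trans_le h⟩)
  classical
  -- Only members supported off the smaller ball are summed; the omitted ones are supported in `ball
  -- 0 b`.
  let g : ι → X → ℝ := fun i v => if tsupport (f i) ⊆ (closedBall 0 a)ᶜ then f i v else 0
  have hlf : LocallyFinite fun i => support (g i) := f.locallyFinite.subset fun i v hv h => by
    refine hv ?_
    simp only [g, h, ite_self]
  refine ⟨fun v => ∑ᶠ i, g i v, hlf.contDiff_finsum fun i => ?_, fun v => finsum_nonneg fun i => ?_,
    fun v hv => finsum_eq_zero_of_forall_eq_zero fun i => ?_, fun v hv => ?_⟩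
  · by_cases h : tsupport (f i) ⊆ (closedBall 0 a)ᶜ
    · simpa [g, h] using hf i
    · simpa [g, h] using contDiff_const
  · simp only [g]
    split_ifs
    exacts [f.nonneg i v, le_rfl]
  · simp only [g, ite_eq_right_iff]
    intro h
    by_contra hne
    exact h (subset_tsupport _ hne) (by simpa using hv)
  · rw [← f.sum_eq_one (mem_univ v)]
    refine finsum_congr fun i => ?_
    simp only [g, ite_eq_left_iff]
    intro h
    by_contra hne
    obtain ⟨V, rfl | rfl, hV⟩ := hsub i
    · have := hV (subset_tsupport _ (Ne.symm hne))
      simp at this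
      linarith
    · exact h hV

/-- Partitions of unity subordinate to balls of a given radius. -/
theorem AdmitsPartitionsOfUnity.exists_small (hX : AdmitsPartitionsOfUnity k X) {r : ℝ}
    (hr : 0 < r) :
    ∃ (ι : Type w) (f : PartitionOfUnity ι X univ), (∀ i, ContDiff ℝ k (f i)) ∧
      ∀ i u v, f i u ≠ 0 → f i v ≠ 0 → ‖u - v‖ < 2 * r := by
  obtain ⟨ι, f, hf, hsub⟩ := hX (range fun c => ball c r)
    (by rintro _ ⟨c, rfl⟩; exact isOpen_ball)
    (eq_univ_of_forall fun v => ⟨_, ⟨v, rfl⟩, mem_ball_self hr⟩)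
  refine ⟨ι, f, hf, fun i u v hu hv => ?_⟩
  obtain ⟨_, ⟨c, rfl⟩, hc⟩ := hsub i
  have h1 := mem_ball.1 (hc (subset_tsupport _ hu))
  have h2 := mem_ball.1 (hc (subset_tsupport _ hv))
  rw [← dist_eq_norm]
  linarith [dist_triangle_right u v c]

end Urysohn

/-! ### Jumps and step-function approximation. -/

namespace WellOrderedCompact

open Set Function Filter Topology Metric

variable {K : Type*} [TopologicalSpace K] {E : Type*} [NormedAddCommGroup E] [NormedSpace ℝ E]

/-- Evaluation at a point of `K`, or `0` past the top. -/
noncomputable def evalTop (a : WithTop K) : C(K, E) →L[ℝ] E :=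
  WithTop.recTopCoe (C := fun _ => C(K, E) →L[ℝ] E) 0 (fun α => ContinuousMap.evalCLM ℝ α) a

@[simp] theorem evalTop_top (x : C(K, E)) : evalTop (⊤ : WithTop K) x = 0 := rfl

@[simp] theorem evalTop_coe (α : K) (x : C(K, E)) : evalTop (α : WithTop K) x = x α := rfl

variable [LinearOrder K]

/-- The difference at `β` between `x` and the step function which agrees with `x` on `F`,
is constant between consecutive points of `F`, and vanishes beyond `F`. -/
noncomputable def dev (F : Finset K) (β : K) : C(K, E) →L[ℝ] E :=
  ContinuousMap.evalCLM ℝ β - evalTop (F.filter (β ≤ ·)).min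

theorem dev_apply (F : Finset K) (β : K) (x : C(K, E)) :
    dev F β x = x β - evalTop (F.filter (β ≤ ·)).min x := rfl

theorem dev_of_mem {F : Finset K} {β : K} (h : β ∈ F) (x : C(K, E)) : dev F β x = 0 := by
  have : (F.filter (β ≤ ·)).min = β := le_antisymm
    (Finset.min_le (by simpa using h))
    (Finset.le_min fun b hb => WithTop.coe_le_coe.2 (Finset.mem_filter.1 hb).2)
  simp [dev_apply, this]

/-- The step function at `γ` only sees points of `F` at or above `γ`. Adding a point thus never
spoils the approximation further up. -/
theorem dev_insert_of_lt (F : Finset K) {β γ : K} (h : β < γ) (x : C(K, E)) :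
    dev (insert β F) γ x = dev F γ x := by
  rw [dev_apply, dev_apply, Finset.filter_insert, if_neg h.not_ge]

theorem norm_sub_le_of_norm_dev_le {F : Finset K} {x y : C(K, E)} {ε δ : ℝ} (hδ : 0 ≤ δ)
    (hx : ∀ β, ‖dev F β x‖ ≤ ε) (hy : ∀ β, ‖dev F β y‖ ≤ ε) (hF : ∀ α ∈ F, ‖x α - y α‖ ≤ δ)
    (β : K) : ‖x β - y β‖ ≤ 2 * ε + δ := by
  have h : ‖evalTop (F.filter (β ≤ ·)).min x - evalTop (F.filter (β ≤ ·)).min y‖ ≤ δ := by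
    cases hα : (F.filter (β ≤ ·)).min using WithTop.recTopCoe with
    | top => simpa using hδ
    | coe α => exact hF α (Finset.mem_filter.1 (Finset.mem_of_min hα)).1
  have h1 : x β - y β = dev F β x - dev F β y +
      (evalTop (F.filter (β ≤ ·)).min x - evalTop (F.filter (β ≤ ·)).min y) := by
    simp only [dev_apply]
    abel
  rw [h1]
  linarith [norm_add_le (dev F β x - dev F β y)
    (evalTop (F.filter (β ≤ ·)).min x - evalTop (F.filter (β ≤ ·)).min y),
    norm_sub_le (dev F β x) (dev F β y), hx β, hy β]

section

variable [CompactSpace K]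

theorem norm_dev_le (F : Finset K) (β : K) (x : C(K, E)) : ‖dev F β x‖ ≤ 2 * ‖x‖ := by
  have h : ‖evalTop (F.filter (β ≤ ·)).min x‖ ≤ ‖x‖ := by
    induction (F.filter (β ≤ ·)).min using WithTop.recTopCoe with
    | top => simp
    | coe α => exact x.norm_coe_le_norm α
  rw [dev_apply]
  linarith [norm_sub_le (x β) (evalTop (F.filter (β ≤ ·)).min x), x.norm_coe_le_norm β]

end

variable [SuccOrder K]

open Classical in
/-- The jump of `x` from `α` to its successor, where `x` is extended by `0` past the top. -/
noncomputable def jump (α : K) : C(K, E) →L[ℝ] E :=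
  if IsMax α then -ContinuousMap.evalCLM ℝ α
  else ContinuousMap.evalCLM ℝ (Order.succ α) - ContinuousMap.evalCLM ℝ α

theorem jump_of_isMax {α : K} (h : IsMax α) (x : C(K, E)) : jump α x = -x α := by
  simp [jump, h]

theorem jump_of_not_isMax {α : K} (h : ¬IsMax α) (x : C(K, E)) :
    jump α x = x (Order.succ α) - x α := by
  simp [jump, h]

section

variable [CompactSpace K]

theorem norm_jump_le (α : K) (x : C(K, E)) : ‖jump α x‖ ≤ 2 * ‖x‖ := by
  by_cases h : IsMax α
  · rw [jump_of_isMax h, norm_neg]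
    linarith [x.norm_coe_le_norm α, norm_nonneg x]
  · rw [jump_of_not_isMax h]
    linarith [norm_sub_le (x (Order.succ α)) (x α), x.norm_coe_le_norm α,
      x.norm_coe_le_norm (Order.succ α)]

end

variable [OrderTopology K]

theorem isOpen_Iic (α : K) : IsOpen (Iic α) := by
  by_cases h : IsMax α
  · rw [eq_univ_of_forall fun β : K => show β ∈ Iic α from h.isTop β]
    exact isOpen_univ
  · rw [← Order.Iio_succ_of_not_isMax h]
    exact isOpen_Iio

/-- Each `Iic α` is clopen, so the least point of `F` at or above `β` is locally constant in `β`. -/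
theorem continuous_dev (F : Finset K) (x : C(K, E)) : Continuous fun β => dev F β x := by
  refine x.continuous.sub (continuous_iff_continuousAt.2 fun β => ?_)
  have h : ∀ᶠ γ in 𝓝 β, ∀ α ∈ F, γ ≤ α ↔ β ≤ α := by
    refine (F.eventually_all).2 fun α _ => ?_
    rcases le_or_gt β α with h | h
    · filter_upwards [(isOpen_Iic α).mem_nhds h] with γ hγ using iff_of_true hγ h
    · filter_upwards [isOpen_Ioi.mem_nhds h] with γ hγ using iff_of_false hγ.not_ge h.not_ge
  refine (continuousAt_const (y := evalTop (F.filter (β ≤ ·)).min x)).congr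
    (h.mono fun γ hγ => ?_)
  change evalTop _ x = evalTop _ x
  rw [Finset.filter_congr hγ]

variable [CompactSpace K]

/-- Otherwise large jumps accumulate at some `l`. Near `l` they occur at points `β < l`, where `β`
and its successor both lie close to `l` on the left, so continuity at `l` makes the jump small. -/
theorem finite_norm_jump_ge (x : C(K, E)) {δ : ℝ} (hδ : 0 < δ) :
    {α | δ ≤ ‖jump α x‖}.Finite := by
  by_contra hinf
  obtain ⟨l, hl⟩ := Set.Infinite.exists_accPt_principal hinf
  have hU : ∀ᶠ β in 𝓝 l, dist (x β) (x l) < δ / 2 :=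
    x.continuous.continuousAt.eventually (ball_mem_nhds _ (half_pos hδ))
  have hV : ∀ᶠ β in 𝓝 l, β ≠ l → ‖jump β x‖ < δ := by
    by_cases hmin : ∃ m, m < l
    · obtain ⟨m, hm, hsub⟩ := exists_Ioc_subset_of_mem_nhds hU hmin
      filter_upwards [(isOpen_Iic l).mem_nhds self_mem_Iic, isOpen_Ioi.mem_nhds hm]
        with β hβ hmβ hne
      have hlt : β < l := lt_of_le_of_ne hβ hne
      have h1 := hsub ⟨hmβ, hβ⟩
      have h2 := hsub ⟨lt_of_lt_of_le hmβ (Order.le_succ β), Order.succ_le_of_lt hlt⟩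
      rw [jump_of_not_isMax hlt.not_isMax, ← dist_eq_norm]
      simp only [mem_ofPred_eq] at h1 h2
      linarith [dist_triangle_right (x (Order.succ β)) (x β) (x l)]
    · filter_upwards [(isOpen_Iic l).mem_nhds self_mem_Iic] with β hβ hne
      exact (hmin ⟨β, lt_of_le_of_ne hβ hne⟩).elim
  obtain ⟨β, ⟨hβ, hβ'⟩, hne⟩ := ((accPt_iff_nhds.1 hl) _ hV)
  exact (hβ hne).not_ge hβ'

/-- If `x` is not uniformly close to its step function, then the last point where this is witnessed
is a jump point of `x`. -/
theorem exists_last_jump (F : Finset K) (x : C(K, E)) {ε : ℝ} (hε : 0 < ε)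
    (h : ∃ β, ε ≤ ‖dev F β x‖) :
    ∃ β, ε ≤ ‖dev F β x‖ ∧ jump β x ≠ 0 ∧ ∀ γ, β < γ → ‖dev F γ x‖ < ε := by
  have hcl : IsClosed {β | ε ≤ ‖dev F β x‖} :=
    isClosed_le continuous_const (continuous_dev F x).norm
  obtain ⟨β, hβ, hmax⟩ := hcl.isCompact.exists_isGreatest h
  have hlast : ∀ γ, β < γ → ‖dev F γ x‖ < ε := fun γ hγ =>
    lt_of_not_ge fun h' => (hmax h').not_gt hγ
  refine ⟨β, hβ, fun hj => ?_, hlast⟩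
  have hne : dev F β x ≠ 0 := fun h0 => by
    rw [mem_ofPred_eq, h0, norm_zero] at hβ
    exact hβ.not_gt hε
  have hF : β ∉ F := fun h' => hne (dev_of_mem h' x)
  -- With zero jump, the deviation at the successor would equal that at `β`, against maximality. At
  -- the top, extension by `0` makes zero jump mean `x β = 0`.
  by_cases hm : IsMax β
  · rw [jump_of_isMax hm, neg_eq_zero] at hj
    have : F.filter (β ≤ ·) = ∅ := Finset.filter_eq_empty_iff.2 fun α hα hle =>
      hF (hm.eq_of_le hle ▸ hα)
    exact hne (by simp [dev_apply, this, hj])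
  · rw [jump_of_not_isMax hm, sub_eq_zero] at hj
    have hs := hlast _ (Order.lt_succ_of_not_isMax hm)
    have : F.filter (Order.succ β ≤ ·) = F.filter (β ≤ ·) := Finset.filter_congr fun α hα => by
      rw [Order.succ_le_iff_of_not_isMax hm]
      exact ⟨le_of_lt, fun hle => lt_of_le_of_ne hle fun h' => hF (h' ▸ hα)⟩
    rw [dev_apply, hj, this, ← dev_apply] at hs
    exact hs.not_ge hβ

/-- Every `x` is uniformly close to its step function over some finite set of jump points. -/
theorem exists_finset_norm_dev_lt [WellFoundedLT K] (x : C(K, E)) {ε : ℝ} (hε : 0 < ε) :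
    ∃ F : Finset K, (∀ α ∈ F, jump α x ≠ 0) ∧ ∀ β, ‖dev F β x‖ < ε := by
  have step : ∀ F : Finset K, (∀ α ∈ F, jump α x ≠ 0) → (∀ β, ‖dev F β x‖ < ε) ∨
      ∃ β, ε ≤ ‖dev F β x‖ ∧ (∀ α ∈ insert β F, jump α x ≠ 0) ∧
        ∀ γ, β ≤ γ → ‖dev (insert β F) γ x‖ < ε := fun F hF => by
    by_cases h : ∃ β, ε ≤ ‖dev F β x‖
    · obtain ⟨β, hβ, hj, hlast⟩ := exists_last_jump F x hε h
      refine Or.inr ⟨β, hβ, by simpa [hj] using hF, fun γ hγ => ?_⟩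
      rcases hγ.eq_or_lt with rfl | hlt
      · simpa [dev_of_mem (Finset.mem_insert_self β F)] using hε
      · rw [dev_insert_of_lt F hlt]
        exact hlast γ hlt
    · exact Or.inl (by simpa using h)
  -- Inserting the last bad point makes every later bad point strictly smaller, so the process ends
  -- by well-foundedness.
  have main : ∀ γ : K, ∀ F : Finset K, (∀ α ∈ F, jump α x ≠ 0) →
      (∀ β, γ ≤ β → ‖dev F β x‖ < ε) →
        ∃ F : Finset K, (∀ α ∈ F, jump α x ≠ 0) ∧ ∀ β, ‖dev F β x‖ < ε := by
    intro γ
    induction γ using WellFoundedLT.induction with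
    | ind γ ih =>
      intro F hF hγ
      rcases step F hF with h | ⟨β, hβ, hF', hlast⟩
      · exact ⟨F, hF, h⟩
      · exact ih β (lt_of_not_ge fun h => (hγ β h).not_ge hβ) _ hF' hlast
  rcases step ∅ (by simp) with h | ⟨β, _, hF', hlast⟩
  · exact ⟨∅, by simp, h⟩
  · exact main β _ hF' hlast

theorem eventually_norm_jump_lt (x : C(K, E)) {a : ℝ} (ha : 0 < a) :
    ∃ S : Finset K, ∀ᶠ y in 𝓝 x, ∀ α ∉ S, ‖jump α y‖ < a := by
  refine ⟨(finite_norm_jump_ge x (half_pos ha)).toFinset, ?_⟩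
  filter_upwards [ball_mem_nhds x (show 0 < a / 4 by positivity)] with y hy α hα
  have h1 : ‖jump α x‖ < a / 2 := by simpa using hα
  have h2 := norm_jump_le α (y - x)
  rw [mem_ball, dist_eq_norm] at hy
  rw [map_sub] at h2
  linarith [norm_le_norm_add_norm_sub' (jump α y) (jump α x)]

end WellOrderedCompact

/-! ### Bump functions and local finiteness on `C(K, E)`. -/

namespace WellOrderedCompact

open Set Function Filter Topology Metric

variable {K : Type*} [TopologicalSpace K] [LinearOrder K] [OrderTopology K] [CompactSpace K]
  [SuccOrder K] {E : Type*} [NormedAddCommGroup E] [NormedSpace ℝ E] {k : ℕ∞}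

/-- Compactness gives a uniform margin, and `dev F β` has norm at most `2` for all `β`, so half of
the margin survives nearby. -/
theorem exists_eventually_norm_dev_le (F : Finset K) {ε : ℝ} (hε : 0 < ε) {x : C(K, E)}
    (hx : ∀ β, ‖dev F β x‖ < ε) :
    ∃ η > 0, ∀ᶠ y in 𝓝 x, ∀ β, ‖dev F β y‖ ≤ ε - η := by
  obtain ⟨η, hη, hη'⟩ : ∃ η > 0, ∀ β, ‖dev F β x‖ ≤ ε - η := by
    cases isEmpty_or_nonempty K
    · exact ⟨ε, hε, fun β => isEmptyElim β⟩
    · obtain ⟨β, -, hβ⟩ := isCompact_univ.exists_isMaxOn univ_nonempty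
        (continuous_dev F x).norm.continuousOn
      exact ⟨ε - ‖dev F β x‖, sub_pos.2 (hx β), fun γ => by simpa using hβ (mem_univ γ)⟩
  refine ⟨η / 2, half_pos hη, ?_⟩
  filter_upwards [ball_mem_nhds x (show 0 < η / 4 by positivity)] with y hy β
  have h1 := hη' β
  have h2 := norm_dev_le F β (y - x)
  rw [mem_ball, dist_eq_norm] at hy
  rw [map_sub] at h2
  linarith [norm_le_norm_add_norm_sub' (dev F β y) (dev F β x)]

/-- A `C^k` function on `C(K, E)` which controls the distance to a step function. -/
theorem exists_bump (hE : AdmitsPartitionsOfUnity k E) (F : Finset K) {ε : ℝ} (hε : 0 < ε) :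
    ∃ φ : C(K, E) → ℝ, ContDiff ℝ k φ ∧ (∀ x, 0 ≤ φ x) ∧
      (∀ x, (∀ β, ‖dev F β x‖ ≤ ε / 2) → φ x ≠ 0) ∧
      ∀ x, φ x ≠ 0 → ∀ β, ‖dev F β x‖ < ε := by
  classical
  have hlt : ∀ j : ℕ, 1 / ((j : ℝ) + 2) < 1 / (j + 1) := fun j => by gcongr; norm_num
  have hlt' : ∀ j : ℕ, ε * (1 - 1 / ((j : ℝ) + 2)) < ε * (1 - 1 / (j + 3)) := fun j => by
    gcongr; norm_num
  choose ψ hψ hψ0 hψz hψ1 using fun j => hE.exists_separating (hlt j)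
  choose ρ hρ hρ0 hρz hρ1 using fun j => hE.exists_separating (hlt' j)
  -- As `j` grows, `ψ j` detects ever smaller jumps and `ρ j` only deviations ever closer to `ε`.
  -- The thresholds of `ρ` start at `ε / 2`, so all terms vanish when the deviations stay below
  -- that.
  let u : ℕ × K → C(K, E) → ℝ := fun p x => ψ p.1 (jump p.2 x) * ρ p.1 (dev F p.2 x)
  have hu : ∀ p, ContDiff ℝ k (u p) := fun p =>
    ((hψ _).comp (jump p.2).contDiff).mul ((hρ _).comp (dev F p.2).contDiff)
  have hu0 : ∀ p x, 0 ≤ u p x := fun p x => mul_nonneg (hψ0 _ _) (hρ0 _ _)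
  let O : Set C(K, E) := {x | ∀ β, ‖dev F β x‖ < ε}
  have hO : ∀ x ∈ O, ∀ᶠ y in 𝓝 x, y ∈ O := fun x hx => by
    obtain ⟨η, hη, h⟩ := exists_eventually_norm_dev_le F hε hx
    exact h.mono fun y hy β => (hy β).trans_lt (by linarith)
  -- The margin below `ε` kills `ρ j` for `j ≥ N`; for `j < N`, only the finitely many `β ∈ S` can
  -- have jumps visible to `ψ j`.
  have hfin : ∀ x ∈ O, ∃ I : Finset (ℕ × K), ∀ᶠ y in 𝓝 x, (support fun p => u p y) ⊆ I := by
    intro x hx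
    obtain ⟨η, hη, h⟩ := exists_eventually_norm_dev_le F hε hx
    obtain ⟨N, hN⟩ := exists_nat_one_div_lt (div_pos hη hε)
    obtain ⟨S, hS⟩ := eventually_norm_jump_lt x (show 0 < 1 / ((N : ℝ) + 2) by positivity)
    refine ⟨Finset.range N ×ˢ S, ?_⟩
    filter_upwards [h, hS] with y hy hyS
    rintro ⟨j, β⟩ hj
    by_contra hn
    have hn : N ≤ j ∨ j < N ∧ β ∉ S := by
      rcases le_or_gt N j with h | h
      · exact Or.inl h
      · exact Or.inr ⟨h, fun hβ => hn (by simp [h, hβ])⟩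
    rcases hn with hNj | ⟨hjN, hβ⟩
    · refine hj (mul_eq_zero_of_right _ (hρz _ _ ((hy β).trans ?_)))
      have h1 : 1 / ((j : ℝ) + 2) ≤ 1 / (N + 1) := by
        have : (N : ℝ) ≤ j := by exact_mod_cast hNj
        gcongr
        norm_num
      have h2 : ε * (1 / ((j : ℝ) + 2)) ≤ η := by
        rw [← le_div_iff₀' hε]
        exact h1.trans hN.le
      linarith
    · refine hj (mul_eq_zero_of_left (hψz _ _ ((hyS β hβ).le.trans ?_)) _)
      have : (j : ℝ) ≤ N := by exact_mod_cast hjN.le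
      gcongr
  -- The last jump point gives a term equal to `1` near `x`, so the cut-off vanishes on the part of
  -- `O` near `x` and extends by `0`.
  have hout : ∀ x ∉ O, ∀ᶠ y in 𝓝 x, y ∈ O → 1 ≤ ∑ᶠ p, u p y := by
    intro x hx
    obtain ⟨β, hβ, hj, -⟩ := exists_last_jump F x hε (by simpa [O] using hx)
    obtain ⟨j, hj⟩ := exists_nat_one_div_lt (norm_pos_iff.2 hj)
    have hβ' : ε * (1 - 1 / ((j : ℝ) + 3)) < ‖dev F β x‖ := by
      refine lt_of_lt_of_le ?_ hβ
      have : 0 < ε * (1 / ((j : ℝ) + 3)) := by positivity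
      linarith
    filter_upwards [(jump β).continuous.norm.continuousAt.eventually (lt_mem_nhds hj),
      (dev F β).continuous.norm.continuousAt.eventually (lt_mem_nhds hβ')] with y h1 h2 hy
    obtain ⟨I, hI⟩ := hfin y hy
    have h3 : u (j, β) y = 1 := by
      simp only [u, hψ1 _ _ h1.le, hρ1 _ _ h2.le, mul_one]
    exact h3.ge.trans (single_le_finsum (j, β) (I.finite_toSet.subset hI.self_of_nhds)
      fun p => hu0 p y)
  refine ⟨fun x => if x ∈ O then smoothCutoff (∑ᶠ p, u p x) else 0,
    contDiff_iff_contDiffAt.2 fun x => ?_, fun x => ?_, fun x hx => ?_, fun x hx => ?_⟩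
  · by_cases hx : x ∈ O
    · obtain ⟨I, hI⟩ := hfin x hx
      have h := (contDiff_smoothCutoff (k := k)).contDiffAt.comp x
        (contDiffAt_finsum (fun p => (hu p).contDiffAt) hI)
      exact h.congr_of_eventuallyEq ((hO x hx).mono fun y hy => if_pos hy)
    · refine (contDiffAt_const (c := (0 : ℝ))).congr_of_eventuallyEq
        ((hout x hx).mono fun y hy => ?_)
      by_cases hyO : y ∈ O
      · exact (if_pos hyO).trans (smoothCutoff_of_one_le (hy hyO))
      · exact if_neg hyO
  · dsimp only
    split_ifs
    exacts [smoothCutoff_nonneg _, le_rfl]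
  · have hxO : x ∈ O := fun β => (hx β).trans_lt (half_lt_self hε)
    have h0 : ∀ p, u p x = 0 := fun p => by
      refine mul_eq_zero_of_right _ (hρz _ _ ((hx _).trans ?_))
      have : 1 / ((p.1 : ℝ) + 2) ≤ 1 / 2 := by
        gcongr
        linarith [p.1.cast_nonneg (α := ℝ)]
      nlinarith
    simp [hxO, h0, smoothCutoff_zero]
  · by_contra h
    exact hx (if_neg h)

/-- If `s` indexes products of members of a locally finite family, the products form a locally
finite family. -/
theorem _root_.LocallyFinite.finset_prod {X ι : Type*} [TopologicalSpace X] {h : ι → X → ℝ}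
    (hlf : LocallyFinite fun i => support (h i)) :
    LocallyFinite fun s : Finset ι => support fun x => ∏ i ∈ s, h i x := by
  intro x
  obtain ⟨I, hI⟩ := hlf.exists_finset_support x
  refine ⟨_, hI, I.powerset.finite_toSet.subset ?_⟩
  rintro s ⟨y, hy, hyI⟩
  exact Finset.mem_coe.2 (Finset.mem_powerset.2 fun i hi => hyI (Finset.prod_ne_zero_iff.1 hy i hi))

/-- Near `x` only finitely many `α` have a jump exceeding `a`, and for each of these the family `g`
is locally finite near `x α`. -/
theorem locallyFinite_jump_mul {ι : Type*} {ψ : E → ℝ} {a : ℝ} (ha : 0 < a)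
    (hψ : ∀ v, ‖v‖ ≤ a → ψ v = 0) {g : ι → E → ℝ} (hg : LocallyFinite fun i => support (g i)) :
    LocallyFinite fun p : K × ι => support fun x : C(K, E) => ψ (jump p.1 x) * g p.2 (x p.1) := by
  intro x
  obtain ⟨S, hS⟩ := eventually_norm_jump_lt x ha
  choose t ht htfin using fun α => hg (x α)
  refine ⟨{y | ∀ α ∉ S, ‖jump α y‖ < a} ∩ ⋂ α ∈ S, (fun y : C(K, E) => y α) ⁻¹' t α,
    inter_mem hS ((biInter_finset_mem _).2 fun α _ =>
      (ContinuousMap.evalCLM ℝ α).continuous.continuousAt (ht α)),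
    (S.finite_toSet.biUnion fun α _ => (htfin α).image (Prod.mk α)).subset ?_⟩
  rintro ⟨α, i⟩ ⟨y, hy, hyS, hyt⟩
  have hα : α ∈ S := by
    by_contra hα
    exact left_ne_zero_of_mul hy (hψ _ (hyS α hα).le)
  exact mem_biUnion hα ⟨i, ⟨y α, right_ne_zero_of_mul hy, mem_iInter₂.1 hyt α hα⟩, rfl⟩

end WellOrderedCompact

/-! ### Assembling the base. -/

section WellOrdered

open Set Function Filter Topology Metric WellOrderedCompact

/-- If `K` is a compact well-ordered space and `E` admits `C^k` partitions of unity, then so does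
`C(K, E)`. -/
theorem AdmitsPartitionsOfUnity.continuousMap {k : ℕ∞} {K : Type u} [TopologicalSpace K]
    [LinearOrder K] [OrderTopology K] [CompactSpace K] [SuccOrder K] [WellFoundedLT K]
    {E : Type v} [NormedAddCommGroup E] [NormedSpace ℝ E] (hE : AdmitsPartitionsOfUnity k E) :
    AdmitsPartitionsOfUnity k C(K, E) := by
  classical
  have hε : ∀ m : ℕ, 0 < 1 / ((m : ℝ) + 1) := fun m => by positivity
  have hlt : ∀ j : ℕ, 1 / ((j : ℝ) + 2) < 1 / (j + 1) := fun j => by gcongr; norm_num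
  choose ψ hψ hψ0 hψz hψ1 using fun n => hE.exists_separating (hlt n)
  choose G g hg hgs using fun m => hE.exists_small (hε m)
  choose φ hφ hφ0 hφ1 hφs using fun (m : ℕ) (F : Finset K) => exists_bump hE F (hε m)
  let h : ∀ q : ℕ, K × G q.unpair.2 → C(K, E) → ℝ := fun q p x =>
    ψ q.unpair.1 (jump p.1 x) * g q.unpair.2 p.2 (x p.1)
  have hhlf : ∀ q, LocallyFinite fun p => support (h q p) := fun q =>
    locallyFinite_jump_mul (by positivity) (hψz _) (g _).locallyFinite
  -- Here `q` encodes the jump threshold and the precision. Local finiteness comes from the product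
  -- alone; none is needed for `φ` as its finite set varies.
  let f : ∀ q : ℕ, Finset (K × G q.unpair.2) → C(K, E) → ℝ := fun q s x =>
    (∏ p ∈ s, h q p x) * φ q.unpair.2 (s.image Prod.fst) x
  have hdiam : ∀ q s x y, f q s x ≠ 0 → f q s y ≠ 0 →
      dist x y ≤ 4 * (1 / ((q.unpair.2 : ℝ) + 1)) := by
    intro q s x y hx hy
    have hpos := hε q.unpair.2
    refine (ContinuousMap.dist_le (by positivity)).2 fun β => ?_
    rw [dist_eq_norm]
    refine (norm_sub_le_of_norm_dev_le (F := s.image Prod.fst) (by positivity)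
      (fun β => (hφs _ _ x (right_ne_zero_of_mul hx) β).le)
      (fun β => (hφs _ _ y (right_ne_zero_of_mul hy) β).le) (fun α hα => ?_) β).trans_eq
      (show 2 * (1 / ((q.unpair.2 : ℝ) + 1)) + 2 * (1 / ((q.unpair.2 : ℝ) + 1)) = _ by ring)
    obtain ⟨p, hp, rfl⟩ := Finset.mem_image.1 hα
    exact (hgs _ p.2 _ _
      (right_ne_zero_of_mul (Finset.prod_ne_zero_iff.1 (left_ne_zero_of_mul hx) p hp))
      (right_ne_zero_of_mul (Finset.prod_ne_zero_iff.1 (left_ne_zero_of_mul hy) p hp))).le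
  refine .of_sigmaLocallyFinite_base (f := f) (fun q s => ?_) (fun q s x => ?_) (fun q => ?_)
    fun x r hr => ?_
  · exact (contDiff_prod fun p _ => ((hψ _).comp (jump p.1).contDiff).mul
      ((hg _ _).comp (ContinuousMap.evalCLM ℝ p.1).contDiff)).mul (hφ _ _)
  · exact mul_nonneg (Finset.prod_nonneg fun p _ => mul_nonneg (hψ0 _ _) ((g _).nonneg _ _))
      (hφ0 _ _ _)
  · exact (hhlf q).finset_prod.subset fun s x hx => left_ne_zero_of_mul hx
  · obtain ⟨m, hm⟩ := exists_nat_one_div_lt (show 0 < r / 4 by positivity)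
    -- Half the precision is what guarantees that the bump over `F` is nonzero at `x`. The jumps on
    -- the finite set `F` are nonzero, so one threshold `n` lies below all of them.
    obtain ⟨F, hF, hFdev⟩ := exists_finset_norm_dev_lt x (half_pos (hε m))
    obtain ⟨n, hn⟩ : ∃ n : ℕ, ∀ α ∈ F, 1 / ((n : ℝ) + 1) < ‖jump α x‖ :=
      ((F.eventually_all).2 fun α hα => tendsto_one_div_add_atTop_nhds_zero_nat.eventually
        (gt_mem_nhds (norm_pos_iff.2 (hF α hα)))).exists
    obtain ⟨q, hq1, hq2⟩ : ∃ q : ℕ, q.unpair.1 = n ∧ q.unpair.2 = m :=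
      ⟨Nat.pair n m, by simp, by simp⟩
    subst hq1 hq2
    choose i hi using fun α => (g q.unpair.2).exists_pos (mem_univ (x α))
    have hs : (F.image fun α => (α, i α)).image Prod.fst = F := by
      simp [Finset.image_image, Function.comp_def]
    have hx : f q (F.image fun α => (α, i α)) x ≠ 0 := by
      refine mul_ne_zero (Finset.prod_ne_zero_iff.2 fun p hp => ?_) ?_
      · obtain ⟨α, hα, rfl⟩ := Finset.mem_image.1 hp
        exact mul_ne_zero (by simp [hψ1 _ _ (hn α hα).le]) (hi α).ne'
      · rw [hs]
        exact hφ1 _ _ _ fun β => (hFdev β).le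
    refine ⟨q, _, hx, ?_⟩
    refine (closure_minimal (fun y hy => ?_) isClosed_closedBall).trans
      (closedBall_subset_ball (show 4 * (1 / ((q.unpair.2 : ℝ) + 1)) < r by linarith))
    exact hdiam _ _ y x hy hx

end WellOrdered

theorem corollary5 (k : ℕ∞) (hk : 1 ≤ k) (Ω : Ordinal.{u})
    (E : Type v) [NormedAddCommGroup E] [NormedSpace ℝ E] [CompleteSpace E]
    (hE : AdmitsPartitionsOfUnity k E) :
    AdmitsPartitionsOfUnity k C(Set.Icc (0 : Ordinal.{u}) Ω, E) :=
  hE.continuousMap
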